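/- Let $\mathbb k$ be an algebraically closed field of characteristic zero and let $\mathfrak g$ be a finite-dimensional simple Lie algebra over $\mathbb k$. Let $\mathfrak g=\bigoplus_{i\in\mathbb Z}\mathfrak g(i)$ be a short $\mathbb Z$-grading, i.e. $\mathfrak g=\mathfrak g(-1)\oplus\mathfrak g(0)\oplus\mathfrak g(1)$ with $\mathfrak g(1)\neq 0$. Let $\mathfrak t$ be a Cartan subalgebra of $\mathfrak g$ contained in $\mathfrak g(0)$, and let $\Pi$ be a set of simple roots of $(\mathfrak g,\mathfrak t)$ such that every $\alpha\in\Pi$ has non-negative degree (that is, its root space lies in $\mathfrak g(i)$ for some $i\ge 0$); let $\Pi(0)\subset\Pi$ be the subset of simple roots of degree $0$. Let $\Delta(1)$ be the set of $\mathfrak t$-weights in $\mathfrak g(1)$, ordered by the root order of $\mathfrak g(0)$ (the partial order generated by the relations $\nu\preccurlyeq\mu$ for $\mu-\nu\in\Pi(0)$), and let $\mathcal E(1)$ be the set of edges of its Hasse diagram, i.e. the set of pairs $(\mu,\nu)\in\Delta(1)\times\Delta(1)$ such that $\mu$ covers $\nu$. Let $h=\mathrm{ht}(\theta)+1$ be the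 Coxeter number of $\mathfrak g$, where $\theta$ is the highest root and the height of a root is the sum of its coefficients with respect to $\Pi$. Then $$2\dim\mathfrak g(1)-\#\mathcal E(1)=h.$$ -/

import Mathlib

/-- The set of weights of `H` in a subspace `V` of `L`: the linear forms `χ` on `H` for which `V`
contains a nonzero simultaneous eigenvector of `H` with eigenvalue `χ`. -/
def weightSet {k L : Type*} [Field k] [LieRing L] [LieAlgebra k L]
    (H : LieSubalgebra k L) (V : Submodule k L) : Set (Module.Dual k H) :=
  {χ | ∃ x ∈ V, x ≠ 0 ∧ ∀ y : H, ⁅(y : L), x⁆ = χ y • x}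

/-- The root order on a set `P` of weights, with respect to a set `S` of simple roots:
`RootLE S P ν μ` (that is, `ν ≼ μ`) if `μ` is reached from `ν` inside `P` by successively adding
elements of `S`. -/
def RootLE {M : Type*} [AddCommGroup M] (S P : Set M) : P → P → Prop :=
  Relation.ReflTransGen fun ν μ => (μ : M) - (ν : M) ∈ S

/-- The edges of the Hasse diagram of an order `le`: the pairs `(μ, ν)` such that `μ` covers `ν`. -/
def hasseEdges {X : Type*} (le : X → X → Prop) : Set (X × X) :=
  {p | p.1 ≠ p.2 ∧ le p.2 p.1 ∧ ∀ γ, le p.2 γ → le γ p.1 → γ = p.1 ∨ γ = p.2}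

/-- If some additive function takes the value `1` on `S` (for instance, if `S` is linearly
independent), then in the root order `μ` covers `ν` if and only if `μ - ν` belongs to `S`. -/
theorem mem_hasseEdges_rootLE_iff {M R : Type*} [AddCommGroup M] [Ring R] [CharZero R]
    (S P : Set M) (f : M →+ R) (hf : ∀ α ∈ S, f α = 1) (μ ν : P) :
    (μ, ν) ∈ hasseEdges (RootLE S P) ↔ (μ : M) - (ν : M) ∈ S := by
  have key : ∀ a b : P, RootLE S P a b → ∃ n : ℕ, f b = f a + n ∧ (n = 0 → a = b) := by
    intro a b hab
    induction hab with
    | refl => exact ⟨0, by simp, fun _ => rfl⟩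
    | tail _ hbc ih =>
      obtain ⟨n, hn, -⟩ := ih
      have h1 := hf _ hbc
      rw [map_sub, sub_eq_iff_eq_add, hn] at h1
      refine ⟨n + 1, ?_, by simp⟩
      rw [h1]
      push_cast
      abel
  constructor
  · rintro ⟨hne, hle, hcov⟩
    simp only at hne hle hcov
    rcases Relation.ReflTransGen.cases_tail hle with h | ⟨c, hνc, hcμ⟩
    · exact absurd h hne
    · rcases hcov c hνc (Relation.ReflTransGen.single hcμ) with rfl | rfl
      · have := hf _ hcμ
        simp at this
      · exact hcμ
  · intro h
    have h1 : f μ = f ν + 1 := by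
      have := hf _ h
      rw [map_sub, sub_eq_iff_eq_add] at this
      rw [this, add_comm]
    refine ⟨?_, Relation.ReflTransGen.single h, ?_⟩
    · rintro (rfl : μ = ν)
      simp at h1
    · intro γ h2 h3
      obtain ⟨n, hn, hn0⟩ := key _ _ h2
      obtain ⟨m, hm, hm0⟩ := key _ _ h3
      simp only at hn hm hn0 hm0 ⊢
      rw [hn, h1, add_assoc, add_left_cancel_iff] at hm
      have : 1 = n + m := by exact_mod_cast hm
      rcases Nat.eq_zero_or_pos m with h0 | h0
      · exact Or.inl (hm0 h0)
      · exact Or.inr (hn0 (by omega)).symm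

/-- The Coxeter number `h = ht(θ) + 1` of an irreducible root system with base `b`, where the
highest root `θ` is the root of largest height. (Negative heights are truncated to `0`, which does
not affect the maximum.) -/
noncomputable def coxeterNumber {ι R M N : Type*} [Fintype ι] [CommRing R] [CharZero R]
    [AddCommGroup M] [Module R M] [AddCommGroup N] [Module R N]
    {P : RootPairing ι R M N} (b : P.Base) : ℕ :=
  1 + Finset.univ.sup fun i => (b.height i).toNat

/-- A short `ℤ`-grading: nontrivial, with `L = 𝒢 (-1) ⊕ 𝒢 0 ⊕ 𝒢 1`. -/
def IsShortGrading {k L : Type*} [Field k] [LieRing L] [LieAlgebra k L]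
    (𝒢 : ℤ → Submodule k L) : Prop :=
  𝒢 1 ≠ ⊥ ∧ ∀ i : ℤ, 𝒢 i ≠ ⊥ → i = -1 ∨ i = 0 ∨ i = 1

/-- The simple roots of degree `0`, i.e. the simple roots of `𝒢 0`, as linear forms on the Cartan
subalgebra `H`. -/
def simpleRootsZero {k L : Type*} [Field k] [CharZero k] [IsAlgClosed k]
    [LieRing L] [LieAlgebra k L] [FiniteDimensional k L] [LieAlgebra.IsSimple k L]
    (𝒢 : ℤ → Submodule k L) (H : LieSubalgebra k L) [H.IsCartanSubalgebra]
    (b : (LieAlgebra.IsKilling.rootSystem H).Base) : Set (Module.Dual k H) :=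
  ((LieAlgebra.IsKilling.rootSystem H).root '' (b.support : Set _)) ∩ weightSet H (𝒢 0)

/-- The set `E(i)` of edges of the Hasse diagram of the weight poset of the `𝒢 0`-module `𝒢 i`. -/
def gradingEdges {k L : Type*} [Field k] [CharZero k] [IsAlgClosed k]
    [LieRing L] [LieAlgebra k L] [FiniteDimensional k L] [LieAlgebra.IsSimple k L]
    (𝒢 : ℤ → Submodule k L) (H : LieSubalgebra k L) [H.IsCartanSubalgebra]
    (b : (LieAlgebra.IsKilling.rootSystem H).Base) (i : ℤ) :
    Set (weightSet H (𝒢 i) × weightSet H (𝒢 i)) :=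
  hasseEdges (RootLE (simpleRootsZero 𝒢 H b) (weightSet H (𝒢 i)))

/-!
Let `T x = ∑ ⟨x, α^∨⟩ α`, the sum being over the roots `α` of degree `1`. Its trace is
`2 dim 𝔤(1)`, since `⟨α, α^∨⟩ = 2`. We compute the diagonal entries of `T` in the basis of simple
roots.

If the simple root `β` has degree `0` and `α` has degree `1`, then shortness of the grading forces
`⟨β, α^∨⟩` to be `1`, `-1` or `0` according to whether only `α - β`, only `α + β`, or neither or
both of them are roots. Hence `T β = ∑ α - ∑ (α - β)`, both sums being over the `α` for which
`α - β` is a root, so `T β` is `β` times the number of edges labelled by `β`.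

The highest root `θ` has full support and degree at most `1`, so all simple roots but one have
degree `0`, and the remaining one has coefficient `1` in `θ`. The diagonal entry at the latter is
therefore `∑ ⟨θ, α^∨⟩`, which equals `h` because `∑ ⟨θ, γ^∨⟩ γ = 2 h θ`, summing over all roots `γ`.
By invariance under the reflection in `θ`, this identity amounts to `∑ ⟨θ, γ^∨⟩⟨γ, θ^∨⟩ = 4 h`. For
positive `γ ≠ θ` the summand is just `⟨θ, γ^∨⟩`, as `⟨γ, θ^∨⟩ ≤ 1`, and `∑ ⟨θ, γ^∨⟩ = 2 ht θ` over
the positive roots because the corresponding sum for a simple root is `2`.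
-/

section Pairing

open RootPairing Finset

variable {ι R M N : Type*} [CommRing R] [AddCommGroup M] [Module R M]
  [AddCommGroup N] [Module R N] {P : RootPairing ι R M N} [P.IsCrystallographic]

omit [P.IsCrystallographic] in
lemma root_sub_mem_range_of_root_add_mem_range {j : ι} {x : M} (hx : P.coroot' j x = 0)
    (h : P.root j + x ∈ Set.range P.root) : P.root j - x ∈ Set.range P.root := by
  obtain ⟨l, hl⟩ := h
  refine P.neg_mem_range_root_iff.1 ⟨P.reflectionPerm j l, ?_⟩
  rw [root_reflectionPerm, hl, map_add, reflection_apply_self, reflection_apply, hx]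
  module

omit [P.IsCrystallographic] in
lemma root_sub_root_mem_iff_of_pairing_eq_zero {i j : ι} (h : P.pairing i j = 0) :
    P.root j - P.root i ∈ Set.range P.root ↔ P.root j + P.root i ∈ Set.range P.root := by
  have hi : P.coroot' j (P.root i) = 0 := by rwa [root_coroot'_eq_pairing]
  refine ⟨fun hsub => ?_, root_sub_mem_range_of_root_add_mem_range hi⟩
  rw [sub_eq_add_neg] at hsub
  simpa using root_sub_mem_range_of_root_add_mem_range (by rw [map_neg, hi, neg_zero]) hsub

lemma root_reflectionPerm_eq_sub_zsmul (i j : ι) :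
    P.root (P.reflectionPerm i j) = P.root j - P.pairingIn ℤ j i • P.root i := by
  rw [root_reflectionPerm, reflection_apply_root' ℤ]

variable [CharZero R]

lemma pairingIn_reflectionPerm_right (i j : ι) :
    P.pairingIn ℤ i (P.reflectionPerm i j) = -P.pairingIn ℤ i j := by
  rw [pairingIn_reflectionPerm, pairingIn_reflectionPerm_self_left]

lemma pairingIn_eq_sum_of_root_eq_sum {s : Finset ι} {i : ι} {a : ι → ℤ}
    (h : P.root i = ∑ l ∈ s, a l • P.root l) (j : ι) :
    P.pairingIn ℤ i j = ∑ l ∈ s, a l * P.pairingIn ℤ l j := by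
  refine FaithfulSMul.algebraMap_injective ℤ R ?_
  have := congrArg (P.coroot' j) h
  simp_rw [map_sum, map_mul, algebraMap_pairingIn]
  simpa [root_coroot'_eq_pairing] using this

lemma pairingIn_eq_add_of_root_eq_add {i j l : ι} (h : P.root l = P.root i + P.root j) (m : ι) :
    P.pairingIn ℤ l m = P.pairingIn ℤ i m + P.pairingIn ℤ j m := by
  refine FaithfulSMul.algebraMap_injective ℤ R ?_
  simp only [map_add, algebraMap_pairingIn, ← root_coroot'_eq_pairing, h]

lemma two_smul_sum_pairingIn_smul_root [Fintype ι] (i : ι) :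
    (2 : ℤ) • ∑ j, P.pairingIn ℤ i j • P.root j =
      (∑ j, P.pairingIn ℤ i j * P.pairingIn ℤ j i) • P.root i := by
  have reindexed : ∑ j, P.pairingIn ℤ i j • P.root j =
      ∑ j, -P.pairingIn ℤ i j • (P.root j - P.pairingIn ℤ j i • P.root i) := by
    rw [← (P.reflectionPerm i).sum_comp]
    simp only [pairingIn_reflectionPerm_right, root_reflectionPerm_eq_sub_zsmul]
  rw [two_smul]
  nth_rewrite 2 [reindexed]
  rw [← sum_add_distrib, sum_smul]
  exact sum_congr rfl fun j _ => by module

end Pairing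

section Height

open RootPairing Finset

variable {ι R M N : Type*} [CommRing R] [CharZero R] [AddCommGroup M] [Module R M]
  [AddCommGroup N] [Module R N] {P : RootPairing ι R M N} (b : P.Base)

lemma height_reflectionPerm_same (i : ι) :
    b.height (P.reflectionPerm i i) = -b.height i :=
  b.height_reflectionPerm_self i

lemma height_reflectionPerm [P.IsCrystallographic] (i j : ι) :
    b.height (P.reflectionPerm i j) = b.height j - P.pairingIn ℤ j i * b.height i := by
  have h : P.root (P.reflectionPerm i j) = P.root j + (-P.pairingIn ℤ j i) • P.root i := by
    rw [root_reflectionPerm_eq_sub_zsmul, neg_smul, sub_eq_add_neg]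
  rw [b.height_add_zsmul h, smul_eq_mul, neg_mul, sub_eq_add_neg]

variable [Fintype ι]

lemma sum_eq_two_mul_sum_height_pos (g : ι → ℤ) (hg : ∀ j, g (P.reflectionPerm j j) = g j) :
    ∑ j, g j = 2 * ∑ j with 0 < b.height j, g j := by
  rw [← sum_filter_add_sum_filter_not univ fun j => 0 < b.height j, two_mul]
  congr 1
  refine sum_nbij' (fun j => P.reflectionPerm j j) (fun j => P.reflectionPerm j j) ?_ ?_
    (fun j _ => P.indexNeg.neg_neg j) (fun j _ => P.indexNeg.neg_neg j) (fun j _ => (hg j).symm)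
  all_goals
    intro j hj
    have := b.height_ne_zero j
    simp only [mem_filter, mem_univ, true_and, height_reflectionPerm_same] at hj ⊢
    omega

variable [IsDomain R] [P.IsCrystallographic] [P.IsReduced]

lemma sum_height_pos_pairingIn_of_mem_support {i : ι} (hi : i ∈ b.support) :
    ∑ j with 0 < b.height j, P.pairingIn ℤ i j = 2 := by
  classical
  have hi' : i ∈ ({j | 0 < b.height j} : Finset ι) := by
    simp [Base.height_one_of_mem_support hi]
  rw [← add_sum_erase _ _ hi', pairingIn_same, add_eq_left]
  refine sum_involution (fun j _ => P.reflectionPerm i j) ?_ ?_ ?_ (by simp)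
  · intro j _
    rw [pairingIn_reflectionPerm_right, add_neg_cancel]
  · intro j _ hne hfix
    have := pairingIn_reflectionPerm_right (P := P) i j
    rw [hfix] at this
    omega
  · intro j hj
    simp only [mem_erase, mem_filter, mem_univ, true_and] at hj ⊢
    refine ⟨fun h => ?_, Base.IsPos.reflectionPerm hj.2 hi hj.1⟩
    have hneg := height_reflectionPerm_same b i
    rw [← P.reflectionPerm_self i j, h] at hj
    have := Base.height_one_of_mem_support hi
    omega

lemma sum_height_pos_pairingIn (i : ι) :
    ∑ j with 0 < b.height j, P.pairingIn ℤ i j = 2 * b.height i := by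
  obtain ⟨a, -, -, ha⟩ := b.exists_root_eq_sum_int i
  simp_rw [pairingIn_eq_sum_of_root_eq_sum ha]
  rw [Base.height_eq_sum ha, mul_sum, sum_comm]
  refine sum_congr rfl fun l hl => ?_
  rw [← mul_sum, sum_height_pos_pairingIn_of_mem_support b hl, mul_comm]

end Height

section HighestRoot

open RootPairing Finset

variable {ι R M N : Type*} [CommRing R] [CharZero R] [AddCommGroup M] [Module R M]
  [AddCommGroup N] [Module R N] {P : RootPairing ι R M N} {b : P.Base} {i j : ι}

/-- A highest root with respect to a base: a root of maximal height. This is the notion entering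
`coxeterNumber`; no uniqueness is built in. -/
def IsHighestRoot (b : P.Base) (i : ι) : Prop :=
  ∀ j, b.height j ≤ b.height i

lemma exists_isHighestRoot [Finite ι] [Nonempty ι] (b : P.Base) : ∃ i, IsHighestRoot b i :=
  Finite.exists_max b.height

namespace IsHighestRoot

lemma height_pos (hi : IsHighestRoot b i) : 0 < b.height i := by
  have := hi (P.reflectionPerm i i)
  rw [height_reflectionPerm_same] at this
  have := b.height_ne_zero i
  omega

lemma coxeterNumber_eq [Fintype ι] (hi : IsHighestRoot b i) :
    (coxeterNumber b : ℤ) = b.height i + 1 := by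
  have hsup : (univ.sup fun j => (b.height j).toNat) = (b.height i).toNat :=
    le_antisymm (Finset.sup_le fun j _ => Int.toNat_le_toNat (hi j))
      (le_sup (f := fun j => (b.height j).toNat) (mem_univ i))
  rw [coxeterNumber, hsup, Nat.cast_add, Int.toNat_of_nonneg hi.height_pos.le, Nat.cast_one,
    add_comm]

variable [IsDomain R] [P.IsCrystallographic]

lemma pairingIn_nonneg [Finite ι] (hi : IsHighestRoot b i) (hj : 0 < b.height j) :
    0 ≤ P.pairingIn ℤ i j := by
  by_contra! hneg
  have hne : P.root i ≠ -P.root j := by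
    rw [Ne, root_eq_neg_iff]
    rintro rfl
    have := hi.height_pos
    rw [height_reflectionPerm_same] at this
    omega
  obtain ⟨l, hl⟩ := P.root_add_root_mem_of_pairingIn_neg hneg hne
  have := b.height_add hl
  have := hi l
  omega

lemma pairingIn_le_one [Finite ι] (hi : IsHighestRoot b i) (hij : j ≠ i) :
    P.pairingIn ℤ j i ≤ 1 := by
  by_contra! htwo
  have hle := hi (P.reflectionPerm (P.reflectionPerm i j) (P.reflectionPerm i j))
  rw [height_reflectionPerm_same, height_reflectionPerm] at hle
  obtain ⟨l, hl⟩ := P.root_sub_root_mem_of_pairingIn_pos (by omega) hij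
  have hlt : b.height j < b.height i := by
    have := b.height_sub hl
    have := b.height_ne_zero l
    have := hi j
    omega
  nlinarith [mul_nonneg (sub_nonneg.2 htwo) hi.height_pos.le]

lemma pairingIn_mul_pairingIn [Finite ι] (hi : IsHighestRoot b i) (hj : 0 < b.height j)
    (hij : j ≠ i) : P.pairingIn ℤ i j * P.pairingIn ℤ j i = P.pairingIn ℤ i j := by
  rcases (hi.pairingIn_nonneg hj).eq_or_lt with hzero | hpos
  · rw [← hzero, zero_mul]
  · have := (P.zero_lt_pairingIn_iff' ℤ).1 hpos
    have := hi.pairingIn_le_one hij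
    rw [show P.pairingIn ℤ j i = 1 by omega, mul_one]

lemma sum_pairingIn_mul_pairingIn [Fintype ι] [P.IsReduced] (hi : IsHighestRoot b i) :
    ∑ j, P.pairingIn ℤ i j * P.pairingIn ℤ j i = 4 * coxeterNumber b := by
  classical
  have hmem : i ∈ ({j | 0 < b.height j} : Finset ι) := by simpa using hi.height_pos
  have hpos := sum_height_pos_pairingIn b i
  rw [← add_sum_erase _ _ hmem, pairingIn_same] at hpos
  rw [sum_eq_two_mul_sum_height_pos b _ (by simp), ← add_sum_erase _ _ hmem, pairingIn_same,
    sum_congr rfl fun j hj => hi.pairingIn_mul_pairingIn (mem_filter.1 (mem_erase.1 hj).2).2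
      (mem_erase.1 hj).1, hi.coxeterNumber_eq]
  linarith

lemma exists_root_eq_sum_pos [Finite ι] [P.IsReduced] [P.IsIrreducible]
    (hi : IsHighestRoot b i) :
    ∃ a : ι → ℤ, (∀ j ∈ b.support, 0 < a j) ∧ P.root i = ∑ j ∈ b.support, a j • P.root j := by
  obtain ⟨a, -, hsign, ha⟩ := b.exists_root_eq_sum_int i
  have hpos := hi.height_pos
  rw [Base.height_eq_sum ha] at hpos
  have hnonneg : 0 ≤ a := (hsign.resolve_right fun h =>
    hpos.not_ge (sum_nonpos fun j _ => h.le j)).le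
  obtain ⟨j₀, hj₀, hj₀pos⟩ :=
    exists_lt_of_sum_lt (s := b.support) (f := 0) (g := a) (by simpa using hpos)
  -- If `a m = 0`, then `0 ≤ ⟨θ, αₘ^∨⟩ = ∑ a l ⟨αₗ, αₘ^∨⟩` has only nonpositive summands, so `m` is
  -- not joined to any `l` with `0 < a l`; the Dynkin diagram being connected, there is no such `m`.
  have hstep (l m : b.support) (hl : 0 < a l) (hlm : b.cartanMatrix m l ≠ 0) : 0 < a m := by
    by_contra! hm
    have hm : a m = 0 := hm.antisymm (hnonneg m)
    have hterm : ∀ l ∈ b.support, a l * P.pairingIn ℤ l m ≤ 0 := by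
      intro l hl
      by_cases hlm : l = m
      · rw [hlm, hm, zero_mul]
      · exact mul_nonpos_of_nonneg_of_nonpos (hnonneg l) (b.pairingIn_le_zero_of_ne hlm hl m.2)
    have hsum := hi.pairingIn_nonneg (Base.isPos_of_mem_support m.2)
    rw [pairingIn_eq_sum_of_root_eq_sum ha] at hsum
    have hprod := (sum_eq_zero_iff_of_nonpos hterm).1 ((sum_nonpos hterm).antisymm hsum) l l.2
    refine hlm ((b.cartanMatrix_apply_eq_zero_iff_symm).1 ?_)
    exact (mul_eq_zero.1 hprod).resolve_left hl.ne'
  refine ⟨a, fun j hj => ?_, ha⟩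
  exact b.induction_on_cartanMatrix (fun l => 0 < a l) (i := ⟨j₀, hj₀⟩) (j := ⟨j, hj⟩)
    hj₀pos hstep

end IsHighestRoot

end HighestRoot

/-- A grading of a root pairing by the degrees `-1`, `0` and `1`, i.e. an assignment of such degrees
to the roots which is the restriction of a linear form. -/
structure ShortRootGrading {ι R M N : Type*} [CommRing R] [AddCommGroup M] [Module R M]
    [AddCommGroup N] [Module R N] (P : RootPairing ι R M N) where
  toDual : Module.Dual R M
  degree : ι → ℤ
  toDual_root : ∀ i, toDual (P.root i) = degree i
  abs_degree_le_one : ∀ i, |degree i| ≤ 1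

namespace ShortRootGrading

open RootPairing Finset

variable {ι R M N : Type*} [CommRing R] [AddCommGroup M] [Module R M]
  [AddCommGroup N] [Module R N] {P : RootPairing ι R M N} (G : ShortRootGrading P) {i j l : ι}

/-- The endomorphism `x ↦ ∑ ⟨x, αⱼ^∨⟩ αⱼ`, the sum being over the roots `αⱼ` of degree `1`. Its
trace is computed in two ways. -/
noncomputable def degreeOneOperator [Fintype ι] : Module.End R M :=
  ∑ j with G.degree j = 1, (P.coroot' j).smulRight (P.root j)

open scoped Classical in
/-- The upper ends `μ` of the edges `(μ, μ - αᵢ)` labelled by `αᵢ` in the Hasse diagram of the roots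
of degree `1`, provided that `αᵢ` is a simple root of degree `0`. -/
noncomputable def upperEnds [Fintype ι] (i : ι) : Finset ι :=
  {j | G.degree j = 1 ∧ P.root j - P.root i ∈ Set.range P.root}

lemma mem_upperEnds [Fintype ι] :
    j ∈ G.upperEnds i ↔ G.degree j = 1 ∧ P.root j - P.root i ∈ Set.range P.root := by
  simp [upperEnds]

lemma trace_degreeOneOperator [Fintype ι] [Module.Free R M] [Module.Finite R M] :
    LinearMap.trace R M G.degreeOneOperator = 2 * #{j | G.degree j = 1} := by
  simp [degreeOneOperator, LinearMap.trace_smulRight, mul_comm]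

lemma degreeOneOperator_root [P.IsCrystallographic] [Fintype ι] (i : ι) :
    G.degreeOneOperator (P.root i) = ∑ j with G.degree j = 1, P.pairingIn ℤ i j • P.root j := by
  simp only [degreeOneOperator, LinearMap.sum_apply, LinearMap.smulRight_apply,
    root_coroot'_eq_pairing, ← P.algebraMap_pairingIn ℤ, algebraMap_smul]

lemma toDual_degreeOneOperator_root [P.IsCrystallographic] [Fintype ι] (i : ι) :
    G.toDual (G.degreeOneOperator (P.root i)) = ∑ j with G.degree j = 1, P.pairingIn ℤ i j := by
  rw [degreeOneOperator_root, map_sum, Int.cast_sum]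
  refine sum_congr rfl fun j hj => ?_
  rw [map_zsmul, G.toDual_root, (mem_filter.1 hj).2, Int.cast_one, zsmul_one]

variable [CharZero R]

lemma sum_mul_degree_eq {s t : Finset ι} {a c : ι → ℤ}
    (h : ∑ j ∈ s, a j • P.root j = ∑ j ∈ t, c j • P.root j) :
    ∑ j ∈ s, a j * G.degree j = ∑ j ∈ t, c j * G.degree j := by
  have := congrArg G.toDual h
  simp only [map_sum, map_zsmul, G.toDual_root, zsmul_eq_mul] at this
  exact_mod_cast this

lemma degree_eq_sum {s : Finset ι} {a : ι → ℤ} (h : P.root i = ∑ j ∈ s, a j • P.root j) :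
    G.degree i = ∑ j ∈ s, a j * G.degree j := by
  simpa using G.sum_mul_degree_eq (s := {i}) (a := 1) (by simpa using h)

lemma degree_of_root_eq_add (h : P.root l = P.root i + P.root j) :
    G.degree l = G.degree i + G.degree j := by
  have := congrArg G.toDual h
  rw [map_add, G.toDual_root, G.toDual_root, G.toDual_root] at this
  exact_mod_cast this

lemma degree_reflectionPerm_same (i : ι) : G.degree (P.reflectionPerm i i) = -G.degree i := by
  have := G.toDual_root (P.reflectionPerm i i)
  rw [root_reflectionPerm, reflection_apply_self, map_neg, G.toDual_root] at this
  exact_mod_cast this.symm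

open scoped Classical in
lemma sum_root_of_root_add_mem [Fintype ι] (hi : G.degree i = 0) :
    ∑ j with G.degree j = 1 ∧ P.root j + P.root i ∈ Set.range P.root, P.root j =
      ∑ j ∈ G.upperEnds i, (P.root j - P.root i) := by
  symm
  have hex (j : ι) (hj : j ∈ G.upperEnds i) : ∃ l, P.root l = P.root j - P.root i :=
    (G.mem_upperEnds.1 hj).2
  choose lower hlower using hex
  refine sum_bij lower (fun j hj => ?_) (fun j hj j' hj' h => ?_) (fun l hl => ?_)
    (fun j hj => (hlower j hj).symm)
  · have hadd : P.root j = P.root (lower j hj) + P.root i := by rw [hlower, sub_add_cancel]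
    have := G.degree_of_root_eq_add hadd
    have := (G.mem_upperEnds.1 hj).1
    rw [mem_filter, ← hadd]
    exact ⟨mem_univ _, by omega, j, rfl⟩
  · have hroot := hlower j hj
    rw [h, hlower j' hj', sub_left_inj] at hroot
    exact P.root.injective hroot.symm
  · obtain ⟨-, hl, j, hadd⟩ := mem_filter.1 hl
    have := G.degree_of_root_eq_add hadd
    have hsub : P.root l = P.root j - P.root i := by rw [hadd, add_sub_cancel_right]
    have hj : j ∈ G.upperEnds i := G.mem_upperEnds.2 ⟨by omega, l, hsub⟩
    exact ⟨j, hj, P.root.injective ((hlower j hj).trans hsub.symm)⟩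

section Crystallographic

variable [P.IsCrystallographic]

lemma degree_reflectionPerm (i j : ι) :
    G.degree (P.reflectionPerm i j) = G.degree j - P.pairingIn ℤ j i * G.degree i := by
  have := G.toDual_root (P.reflectionPerm i j)
  rw [root_reflectionPerm_eq_sub_zsmul, map_sub, map_zsmul, G.toDual_root, G.toDual_root,
    zsmul_eq_mul] at this
  exact_mod_cast this.symm

lemma pairingIn_nonneg_of_root_sub_mem (hi : G.degree i = 0) (hj : G.degree j = 1)
    (h : P.root j - P.root i ∈ Set.range P.root) : 0 ≤ P.pairingIn ℤ i j := by
  obtain ⟨l, hl⟩ := h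
  have hadd : P.root j = P.root l + P.root i := by rw [hl, sub_add_cancel]
  have hdegree := G.degree_of_root_eq_add hadd
  have hpairing := pairingIn_eq_add_of_root_eq_add hadd j
  have hrefl := G.degree_reflectionPerm j l
  have := abs_le.1 (G.abs_degree_le_one (P.reflectionPerm j l))
  rw [pairingIn_same] at hpairing
  rw [hj, mul_one] at hrefl
  omega

lemma pairingIn_nonpos_of_root_add_mem (hi : G.degree i = 0) (hj : G.degree j = 1)
    (h : P.root j + P.root i ∈ Set.range P.root) : P.pairingIn ℤ i j ≤ 0 := by
  obtain ⟨l, hadd⟩ := h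
  have hdegree := G.degree_of_root_eq_add hadd
  have hpairing := pairingIn_eq_add_of_root_eq_add hadd j
  have hrefl := G.degree_reflectionPerm j l
  have := abs_le.1 (G.abs_degree_le_one (P.reflectionPerm j l))
  rw [pairingIn_same] at hpairing
  rw [hj, mul_one] at hrefl
  omega

open scoped Classical in
lemma pairingIn_eq_ite_sub_ite [Finite ι] [IsDomain R] (hi : G.degree i = 0)
    (hj : G.degree j = 1) :
    P.pairingIn ℤ i j = (if P.root j - P.root i ∈ Set.range P.root then 1 else 0) -
      if P.root j + P.root i ∈ Set.range P.root then 1 else 0 := by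
  have hrefl := G.degree_reflectionPerm j i
  have hbound := abs_le.1 (G.abs_degree_le_one (P.reflectionPerm j i))
  rw [hj, mul_one] at hrefl
  have hnonneg := G.pairingIn_nonneg_of_root_sub_mem hi hj
  have hnonpos := G.pairingIn_nonpos_of_root_add_mem hi hj
  rcases lt_trichotomy (P.pairingIn ℤ i j) 0 with hneg | hzero | hpos
  · have hadd : P.root j + P.root i ∈ Set.range P.root := by
      rw [add_comm]
      refine P.root_add_root_mem_of_pairingIn_neg hneg fun h => ?_
      have := G.degree_reflectionPerm_same j
      rw [← P.root_eq_neg_iff.1 h] at this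
      omega
    rw [if_neg (fun h => (hnonneg h).not_gt hneg), if_pos hadd]
    omega
  · have hiff := root_sub_root_mem_iff_of_pairing_eq_zero (P := P) (i := i) (j := j)
      (by rw [← P.algebraMap_pairingIn ℤ, hzero, map_zero])
    rw [hzero, if_congr hiff rfl rfl, sub_self]
  · have hsub : P.root j - P.root i ∈ Set.range P.root := by
      rw [← neg_sub, P.neg_mem_range_root_iff]
      exact P.root_sub_root_mem_of_pairingIn_pos hpos (by rintro rfl; omega)
    rw [if_pos hsub, if_neg (fun h => (hnonpos h).not_gt hpos)]
    omega

variable [Fintype ι]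

open scoped Classical in
lemma degreeOneOperator_root_of_degree_eq_zero [IsDomain R] (hi : G.degree i = 0) :
    G.degreeOneOperator (P.root i) = (#(G.upperEnds i) : R) • P.root i := by
  have hlocal (j : ι) (hj : G.degree j = 1) : P.pairingIn ℤ i j • P.root j =
      (if P.root j - P.root i ∈ Set.range P.root then P.root j else 0) -
        if P.root j + P.root i ∈ Set.range P.root then P.root j else 0 := by
    simp only [G.pairingIn_eq_ite_sub_ite hi hj, sub_smul, ite_zero_smul, one_smul]
  calc G.degreeOneOperator (P.root i)
      = ∑ j ∈ G.upperEnds i, P.root j -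
          ∑ j with G.degree j = 1 ∧ P.root j + P.root i ∈ Set.range P.root, P.root j := by
        rw [degreeOneOperator_root, sum_congr rfl fun j hj => hlocal j (mem_filter.1 hj).2,
          sum_sub_distrib, ← sum_filter, ← sum_filter, filter_filter, filter_filter, upperEnds]
    _ = (#(G.upperEnds i) : R) • P.root i := by
        rw [G.sum_root_of_root_add_mem hi, ← sum_sub_distrib]
        simp only [sub_sub_cancel, sum_const, Nat.cast_smul_eq_nsmul]

lemma sum_pairingIn_of_degree_eq_zero [IsDomain R] (hi : G.degree i = 0) :
    ∑ j with G.degree j = 1, P.pairingIn ℤ i j = 0 := by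
  have := G.toDual_degreeOneOperator_root i
  rw [G.degreeOneOperator_root_of_degree_eq_zero hi, map_smul, G.toDual_root, hi, Int.cast_zero,
    smul_zero] at this
  exact_mod_cast this.symm

lemma sum_pairingIn_mul_degree (i : ι) :
    ∑ j, P.pairingIn ℤ i j * G.degree j = 2 * ∑ j with G.degree j = 1, P.pairingIn ℤ i j := by
  have hneg : ∑ j with G.degree j = -1, P.pairingIn ℤ i j =
      -∑ j with G.degree j = 1, P.pairingIn ℤ i j := by
    rw [← sum_neg_distrib]
    refine sum_nbij' (fun j => P.reflectionPerm j j) (fun j => P.reflectionPerm j j)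
      (fun j hj => ?_) (fun j hj => ?_) (fun j _ => P.indexNeg.neg_neg j)
      (fun j _ => P.indexNeg.neg_neg j) (fun j _ => by simp)
    all_goals
      simp only [mem_filter, mem_univ, true_and, degree_reflectionPerm_same] at hj ⊢
      omega
  have hterm (j : ι) : P.pairingIn ℤ i j * G.degree j =
      (if G.degree j = 1 then P.pairingIn ℤ i j else 0) -
        if G.degree j = -1 then P.pairingIn ℤ i j else 0 := by
    have := abs_le.1 (G.abs_degree_le_one j)
    obtain h | h | h : G.degree j = -1 ∨ G.degree j = 0 ∨ G.degree j = 1 := by omega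
    all_goals simp [h]
  rw [sum_congr rfl fun j _ => hterm j, sum_sub_distrib, ← sum_filter, ← sum_filter, hneg]
  ring

lemma sum_pairingIn_of_isHighestRoot [IsDomain R] [P.IsReduced] {b : P.Base}
    (hi : IsHighestRoot b i) (hdegree : G.degree i = 1) :
    ∑ j with G.degree j = 1, P.pairingIn ℤ i j = coxeterNumber b := by
  have := congrArg G.toDual (two_smul_sum_pairingIn_smul_root (P := P) i)
  rw [hi.sum_pairingIn_mul_pairingIn] at this
  simp only [map_zsmul, map_sum, G.toDual_root, zsmul_eq_mul, hdegree, Int.cast_one,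
    mul_one] at this
  have key : 2 * ∑ j, P.pairingIn ℤ i j * G.degree j = 4 * coxeterNumber b := by
    exact_mod_cast this
  rw [sum_pairingIn_mul_degree] at key
  omega

end Crystallographic

/-- The simple root `αᵢ` has degree `1` and all the others have degree `0`: the grading is the one
obtained by crossing the node `i` of the Dynkin diagram. -/
structure IsCrossedNode (b : P.Base) (i : ι) : Prop where
  mem_support : i ∈ b.support
  degree_eq_one : G.degree i = 1
  degree_eq_zero : ∀ j ∈ b.support, j ≠ i → G.degree j = 0

variable {G} {b : P.Base}

lemma exists_mem_support_degree_pos (hb : ∀ i ∈ b.support, 0 ≤ G.degree i)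
    (hj : G.degree j ≠ 0) : ∃ i ∈ b.support, 0 < G.degree i := by
  by_contra! hle
  obtain ⟨a, -, -, ha⟩ := b.exists_root_eq_sum_int j
  refine hj ((G.degree_eq_sum ha).trans (sum_eq_zero fun i hi => ?_))
  rw [(hle i hi).antisymm (hb i hi), mul_zero]

-- The highest root has full support and degree at most `1`, which leaves room for a single simple
-- root of positive degree.
lemma exists_isCrossedNode [Finite ι] [IsDomain R] [P.IsCrystallographic] [P.IsReduced]
    [P.IsIrreducible] (hb : ∀ i ∈ b.support, 0 ≤ G.degree i) (hj : G.degree j ≠ 0) :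
    ∃ i, G.IsCrossedNode b i := by
  classical
  have : Nonempty ι := ⟨j⟩
  obtain ⟨i, hi, hipos⟩ := exists_mem_support_degree_pos hb hj
  obtain ⟨θ, hθ⟩ := exists_isHighestRoot b
  obtain ⟨a, hapos, ha⟩ := hθ.exists_root_eq_sum_pos
  have hnonneg : ∀ l ∈ b.support.erase i, 0 ≤ a l * G.degree l := fun l hl =>
    mul_nonneg (hapos l (mem_of_mem_erase hl)).le (hb l (mem_of_mem_erase hl))
  have hsum := G.degree_eq_sum ha
  rw [← add_sum_erase _ _ hi] at hsum
  have hθle := (abs_le.1 (G.abs_degree_le_one θ)).2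
  have hile := (abs_le.1 (G.abs_degree_le_one i)).2
  have hge : 1 ≤ a i * G.degree i := mul_pos (hapos i hi) hipos
  have hrest : ∑ l ∈ b.support.erase i, a l * G.degree l = 0 :=
    (by omega : _ ≤ (0 : ℤ)).antisymm (sum_nonneg hnonneg)
  refine ⟨i, hi, by omega, fun l hl hli => ?_⟩
  have hzero := (sum_eq_zero_iff_of_nonneg hnonneg).1 hrest l (mem_erase.2 ⟨hli, hl⟩)
  exact (mul_eq_zero.1 hzero).resolve_left (hapos l hl).ne'

namespace IsCrossedNode

lemma degree_eq_coeff (h : G.IsCrossedNode b i) {a : ι → ℤ}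
    (ha : P.root j = ∑ l ∈ b.support, a l • P.root l) : G.degree j = a i := by
  rw [G.degree_eq_sum ha, sum_eq_single_of_mem i h.mem_support fun l hl hli => by
    rw [h.degree_eq_zero l hl hli, mul_zero], h.degree_eq_one, mul_one]

omit [CharZero R] in
lemma filter_degree_eq_zero [DecidableEq ι] (h : G.IsCrossedNode b i) :
    {j ∈ b.support | G.degree j = 0} = b.support.erase i := by
  ext j
  rw [mem_filter, mem_erase, and_comm]
  refine and_congr_left fun hj => ⟨?_, h.degree_eq_zero j hj⟩
  rintro hzero rfl
  exact zero_ne_one (hzero.symm.trans h.degree_eq_one)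

omit [CharZero R] in
lemma coord_toWeightBasis [P.IsRootSystem] (h : G.IsCrossedNode b i) :
    b.toWeightBasis.coord ⟨i, h.mem_support⟩ = G.toDual := by
  classical
  refine b.toWeightBasis.ext fun j => ?_
  rw [Base.toWeightBasis_apply, Module.Basis.coord_apply, Base.toWeightBasis_repr_root,
    G.toDual_root, Finsupp.single_apply]
  split_ifs with hji
  · rw [hji, h.degree_eq_one, Int.cast_one]
  · rw [h.degree_eq_zero j j.2 fun hj => hji (Subtype.ext hj), Int.cast_zero]

variable [IsDomain R] [P.IsCrystallographic] [P.IsReduced] [P.IsIrreducible]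

lemma degree_of_isHighestRoot [Finite ι] (h : G.IsCrossedNode b i) (hj : IsHighestRoot b j) :
    G.degree j = 1 := by
  obtain ⟨a, hapos, ha⟩ := hj.exists_root_eq_sum_pos
  have := hapos i h.mem_support
  have := h.degree_eq_coeff ha
  have := (abs_le.1 (G.abs_degree_le_one j)).2
  omega

lemma sum_pairingIn [Fintype ι] (h : G.IsCrossedNode b i) :
    ∑ j with G.degree j = 1, P.pairingIn ℤ i j = coxeterNumber b := by
  have : Nonempty ι := ⟨i⟩
  obtain ⟨θ, hθ⟩ := exists_isHighestRoot b
  obtain ⟨a, -, -, ha⟩ := b.exists_root_eq_sum_int θ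
  have hθdegree := h.degree_of_isHighestRoot hθ
  rw [← G.sum_pairingIn_of_isHighestRoot hθ hθdegree]
  simp_rw [pairingIn_eq_sum_of_root_eq_sum ha]
  rw [sum_comm, sum_eq_single_of_mem i h.mem_support fun l hl hli => by
    rw [← mul_sum, G.sum_pairingIn_of_degree_eq_zero (h.degree_eq_zero l hl hli), mul_zero],
    ← h.degree_eq_coeff ha, hθdegree]
  simp only [one_mul]

lemma trace_degreeOneOperator_eq [Fintype ι] [P.IsRootSystem] (h : G.IsCrossedNode b i) :
    LinearMap.trace R M G.degreeOneOperator =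
      ∑ l ∈ b.support with G.degree l = 0, (#(G.upperEnds l) : R) + coxeterNumber b := by
  classical
  have hdiag (l : b.support) : b.toWeightBasis.repr (G.degreeOneOperator (P.root l)) l =
      if (l : ι) = i then (coxeterNumber b : R) else #(G.upperEnds l) := by
    split_ifs with hli
    · have := G.toDual_degreeOneOperator_root i
      rw [h.sum_pairingIn, ← h.coord_toWeightBasis] at this
      obtain rfl : l = ⟨i, h.mem_support⟩ := Subtype.ext hli
      exact_mod_cast this
    · simp [G.degreeOneOperator_root_of_degree_eq_zero (h.degree_eq_zero l l.2 hli)]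
  calc LinearMap.trace R M G.degreeOneOperator
      = ∑ l : b.support, b.toWeightBasis.repr (G.degreeOneOperator (P.root l)) l := by
        simp [LinearMap.trace_eq_matrix_trace R b.toWeightBasis, Matrix.trace,
          LinearMap.toMatrix_apply]
    _ = ∑ l ∈ b.support, if l = i then (coxeterNumber b : R) else #(G.upperEnds l) := by
        rw [sum_congr rfl fun l _ => hdiag l]
        exact sum_coe_sort b.support fun l =>
          if l = i then (coxeterNumber b : R) else #(G.upperEnds l)
    _ = ∑ l ∈ b.support with G.degree l = 0, (#(G.upperEnds l) : R) + coxeterNumber b := by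
        rw [h.filter_degree_eq_zero, ← sum_erase_add _ _ h.mem_support, if_pos rfl,
          sum_congr rfl fun l hl => if_neg (ne_of_mem_erase hl)]

end IsCrossedNode

theorem sum_card_upperEnds_add_coxeterNumber [Fintype ι] [IsDomain R] [P.IsCrystallographic]
    [P.IsReduced] [P.IsIrreducible] [P.IsRootSystem] (hb : ∀ i ∈ b.support, 0 ≤ G.degree i)
    (hj : G.degree j ≠ 0) :
    ∑ i ∈ b.support with G.degree i = 0, #(G.upperEnds i) + coxeterNumber b =
      2 * #{j | G.degree j = 1} := by
  obtain ⟨i, hi⟩ := exists_isCrossedNode hb hj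
  have := Module.Free.of_basis b.toWeightBasis
  have := Module.Finite.of_basis b.toWeightBasis
  have htrace := G.trace_degreeOneOperator
  rw [hi.trace_degreeOneOperator_eq] at htrace
  exact_mod_cast htrace

end ShortRootGrading

section HasseDiagram

open Finset

open scoped Classical in
lemma ncard_hasseEdges_rootLE {M R : Type*} [AddCommGroup M] [Ring R] [CharZero R]
    {S P : Finset M} (f : M →+ R) (hf : ∀ α ∈ S, f α = 1) :
    (hasseEdges (RootLE (S : Set M) (P : Set M))).ncard = ∑ α ∈ S, #{μ ∈ P | μ - α ∈ P} := by
  have hedge (μ ν : (P : Set M)) := mem_hasseEdges_rootLE_iff (S : Set M) P f hf μ ν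
  rw [← card_sigma, ← Set.ncard_coe_finset]
  refine Set.ncard_congr (fun p _ => ⟨p.1 - p.2, p.1⟩) ?_ ?_ ?_
  · rintro ⟨μ, ν⟩ h
    simpa using (hedge μ ν).1 h
  · rintro ⟨μ, ν⟩ ⟨μ', ν'⟩ - - h
    simp only [Sigma.mk.injEq, heq_eq_eq] at h
    obtain ⟨hsub, hμ⟩ := h
    rw [hμ, sub_right_inj] at hsub
    exact Prod.ext (Subtype.ext hμ) (Subtype.ext hsub)
  · rintro ⟨α, μ⟩ h
    simp only [coe_sigma, Set.mem_sigma_iff, mem_coe, mem_filter] at h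
    obtain ⟨hα, hμ, hν⟩ := h
    exact ⟨(⟨μ, hμ⟩, ⟨μ - α, hν⟩), (hedge _ _).2 (by simpa using hα), by simp⟩

namespace ShortRootGrading

variable {ι R M N : Type*} [Fintype ι] [CommRing R] [CharZero R] [AddCommGroup M] [Module R M]
  [AddCommGroup N] [Module R N] {P : RootPairing ι R M N} [P.IsRootSystem]

lemma ncard_hasseEdges_degree_eq_one (G : ShortRootGrading P) (b : P.Base) :
    (hasseEdges (RootLE (P.root '' {i | i ∈ b.support ∧ G.degree i = 0})
      (P.root '' {j | G.degree j = 1}))).ncard =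
      ∑ i ∈ b.support with G.degree i = 0, #(G.upperEnds i) := by
  classical
  have hS : P.root '' {i | i ∈ b.support ∧ G.degree i = 0} =
      ↑({i ∈ b.support | G.degree i = 0}.map P.root) := by simp
  have hP : P.root '' {j | G.degree j = 1} = ↑(({j | G.degree j = 1} : Finset ι).map P.root) := by
    simp
  rw [hS, hP, ncard_hasseEdges_rootLE
    (b.toWeightBasis.constr R fun _ => (1 : R)).toAddMonoidHom, sum_map]
  · refine sum_congr rfl fun i hi => ?_
    rw [filter_map, card_map, filter_filter]
    congr 1
    ext j
    simp only [mem_filter, mem_univ, true_and, mem_upperEnds, Function.comp_apply, mem_map]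
    refine and_congr_right fun hj => ⟨fun ⟨l, _, hl⟩ => ⟨l, hl⟩, fun ⟨l, hl⟩ => ⟨l, ?_, hl⟩⟩
    have := G.degree_of_root_eq_add (i := l) (j := i) (l := j) (by rw [hl, sub_add_cancel])
    rw [(mem_filter.1 hi).2] at this
    omega
  · intro α hα
    obtain ⟨i, hi, rfl⟩ := mem_map.1 hα
    simpa using b.toWeightBasis.constr_basis R (fun _ => (1 : R)) ⟨i, (mem_filter.1 hi).1⟩

end ShortRootGrading

end HasseDiagram

section Weights

open DirectSum LieAlgebra IsKilling

variable {k L : Type*} [Field k] [LieRing L] [LieAlgebra k L] {𝒢 : ℤ → Submodule k L}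
  [GradedLieAlgebra 𝒢] {H : LieSubalgebra k L}

lemma decompose_lie_of_mem_zero {y : L} (hy : y ∈ 𝒢 0) (x : L) (i : ℤ) :
    (decompose 𝒢 ⁅y, x⁆ i : L) = ⁅y, (decompose 𝒢 x i : L)⁆ := by
  induction x using Decomposition.inductionOn 𝒢 with
  | zero => simp
  | @homogeneous j m =>
    have hmem : ⁅y, (m : L)⁆ ∈ 𝒢 j := by
      simpa using SetLike.GradedBracket.bracket_mem hy m.2
    obtain rfl | hij := eq_or_ne j i
    · rw [decompose_of_mem_same 𝒢 hmem, decompose_of_mem_same 𝒢 m.2]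
    · rw [decompose_of_mem_ne 𝒢 hmem hij, decompose_of_mem_ne 𝒢 m.2 hij, lie_zero]
  | add m m' hm hm' => simp only [lie_add, decompose_add, DirectSum.add_apply,
      Submodule.coe_add, hm, hm']

lemma exists_mem_weightSet_of_mem_weightSet_top (hH : H.toSubmodule ≤ 𝒢 0)
    {χ : Module.Dual k H} (hχ : χ ∈ weightSet H ⊤) : ∃ i, χ ∈ weightSet H (𝒢 i) := by
  obtain ⟨x, -, hx0, hx⟩ := hχ
  obtain ⟨i, hi⟩ : ∃ i, decompose 𝒢 x i ≠ 0 := by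
    by_contra! hzero
    exact hx0 ((decompose 𝒢).injective (by rw [decompose_zero]; exact DFinsupp.ext hzero))
  refine ⟨i, decompose 𝒢 x i, SetLike.coe_mem _, by simpa using hi, fun y => ?_⟩
  rw [← decompose_lie_of_mem_zero (hH y.2), hx, decompose_smul]
  rfl

variable [FiniteDimensional k L] [IsKilling k L]

variable (𝒢) in
lemma exists_forall_lie_eq_intCast_smul :
    ∃ z : L, ∀ i, ∀ x ∈ 𝒢 i, ⁅z, x⁆ = (i : k) • x := by
  obtain ⟨z, hz⟩ := LieDerivation.IsKilling.exists_eq_ad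
    (LieDerivation.ofGrading 𝒢 (Int.castAddHom k))
  refine ⟨z, fun i x hx => ?_⟩
  rw [← LieDerivation.ad_apply_apply (R := k), hz, LieDerivation.ofGrading_apply_apply _ _ hx]
  rfl

variable [H.IsCartanSubalgebra]

lemma exists_forall_mem_weightSet_apply_eq (hH : H.toSubmodule ≤ 𝒢 0) :
    ∃ z : H, ∀ i, ∀ χ ∈ weightSet H (𝒢 i), χ z = i := by
  obtain ⟨z, hz⟩ := exists_forall_lie_eq_intCast_smul 𝒢
  have hzH : z ∈ H := by
    rw [← LieSubalgebra.IsCartanSubalgebra.self_normalizing (H := H),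
      LieSubalgebra.mem_normalizer_iff]
    intro y hy
    rw [hz 0 y (hH hy), Int.cast_zero, zero_smul]
    exact H.zero_mem
  refine ⟨⟨z, hzH⟩, ?_⟩
  rintro i χ ⟨x, hx, hx0, hχ⟩
  exact smul_left_injective k hx0 ((hχ ⟨z, hzH⟩).symm.trans (hz i x hx))

variable [CharZero k]

lemma zero_notMem_weightSet (hH : H.toSubmodule ≤ 𝒢 0) {i : ℤ} (hi : i ≠ 0) :
    0 ∉ weightSet H (𝒢 i) := by
  obtain ⟨z, hz⟩ := exists_forall_mem_weightSet_apply_eq hH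
  intro hzero
  have := hz i 0 hzero
  rw [LinearMap.zero_apply] at this
  exact hi (by exact_mod_cast this.symm)

variable [IsAlgClosed k]

lemma root_mem_weightSet_top (α : H.root) : (rootSystem H).root α ∈ weightSet H ⊤ := by
  obtain ⟨x, hx, hx0⟩ := (α : LieModule.Weight k H L).exists_ne_zero
  exact ⟨x, trivial, hx0, fun y => lie_eq_smul_of_mem_rootSpace hx y⟩

lemma mem_rootSpace_iff {χ : Module.Dual k H} {x : L} :
    x ∈ rootSpace H χ ↔ ∀ y : H, ⁅(y : L), x⁆ = χ y • x := by
  refine ⟨lie_eq_smul_of_mem_rootSpace, fun h => ?_⟩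
  exact LieModule.weightSpace_le_genWeightSpace L (χ : H → k) ((LieModule.mem_weightSpace _ _).2 h)

lemma exists_root_eq_of_mem_weightSet {V : Submodule k L} {χ : Module.Dual k H}
    (hχ : χ ∈ weightSet H V) (hχ0 : χ ≠ 0) : ∃ α : H.root, (rootSystem H).root α = χ := by
  obtain ⟨x, -, hx0, hx⟩ := hχ
  have hx := mem_rootSpace_iff.2 hx
  let α : LieModule.Weight k H L :=
    ⟨χ, fun hbot => hx0 (by simpa [show rootSpace H χ = ⊥ from hbot] using hx)⟩
  have hα : α.IsNonZero := fun hzero => hχ0 (LinearMap.ext fun y => congrFun hzero y)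
  exact ⟨⟨α, by simpa using hα⟩, LinearMap.ext fun _ => rfl⟩

lemma mem_span_singleton_of_mem_rootSpace {χ : LieModule.Weight k H L} (hχ : χ.IsNonZero)
    {x y : L} (hx : x ∈ rootSpace H χ) (hx0 : x ≠ 0) (hy : y ∈ rootSpace H χ) :
    y ∈ Submodule.span k {x} := by
  obtain ⟨c, hc⟩ := (finrank_eq_one_iff_of_nonzero' (⟨x, hx⟩ : rootSpace H χ)
    (by simpa using hx0)).1 (finrank_rootSpace_eq_one χ hχ) ⟨y, hy⟩
  exact Submodule.mem_span_singleton.2 ⟨c, congrArg Subtype.val hc⟩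

lemma linearIndependent_of_lie_eq_smul {ι : Type*} {χ : ι → Module.Dual k H}
    (hχ : Function.Injective χ) {x : ι → L} (hx0 : ∀ i, x i ≠ 0)
    (hx : ∀ i, ∀ y : H, ⁅(y : L), x i⁆ = χ i y • x i) : LinearIndependent k x :=
  ((LieSubmodule.iSupIndep_toSubmodule.2 (LieModule.iSupIndep_genWeightSpace k H L)).comp
    (DFunLike.coe_injective.comp hχ)).linearIndependent _ (fun i => mem_rootSpace_iff.2 (hx i)) hx0

lemma le_span_range_of_lie_eq_smul (V : LieSubmodule k H L) (hV : 0 ∉ weightSet H V.toSubmodule)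
    {x : weightSet H V.toSubmodule → L} (hx0 : ∀ χ, x χ ≠ 0)
    (hx : ∀ χ, ∀ y : H, ⁅(y : L), x χ⁆ = χ.1 y • x χ) :
    V.toSubmodule ≤ Submodule.span k (Set.range x) := by
  have hsup := congrArg LieSubmodule.toSubmodule (LieModule.eq_iSup_inf_genWeightSpace k H L V)
  rw [LieSubmodule.iSup_toSubmodule] at hsup
  refine hsup.trans_le (iSup_le ?_)
  rintro χ y ⟨hyV, hy⟩
  obtain rfl | hy0 := eq_or_ne y 0
  · exact Submodule.zero_mem _
  have hχV : χ.toLinear ∈ weightSet H V.toSubmodule :=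
    ⟨y, hyV, hy0, lie_eq_smul_of_mem_rootSpace hy⟩
  have hχ : χ.IsNonZero := fun hzero => hV <| by
    rwa [show χ.toLinear = 0 from LinearMap.ext fun h => congrFun hzero h] at hχV
  have hxχ : x ⟨χ.toLinear, hχV⟩ ∈ rootSpace H χ :=
    mem_rootSpace_iff (χ := χ.toLinear).2 (hx ⟨χ.toLinear, hχV⟩)
  refine Submodule.span_mono ?_ (mem_span_singleton_of_mem_rootSpace hχ hxχ (hx0 _) hy)
  exact Set.singleton_subset_iff.2 (Set.mem_range_self _)

lemma finrank_eq_ncard_weightSet (V : LieSubmodule k H L) (hV : 0 ∉ weightSet H V.toSubmodule) :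
    Module.finrank k V.toSubmodule = (weightSet H V.toSubmodule).ncard := by
  choose x hxV hx0 hx using fun χ : weightSet H V.toSubmodule => χ.2
  have hindep := linearIndependent_of_lie_eq_smul Subtype.val_injective hx0 hx
  have hspan : V.toSubmodule = Submodule.span k (Set.range x) :=
    (le_span_range_of_lie_eq_smul V hV hx0 hx).antisymm
      (Submodule.span_le.2 (Set.range_subset_iff.2 hxV))
  have := hindep.finite
  have := Fintype.ofFinite (weightSet H V.toSubmodule)
  rw [← Nat.card_coe_set_eq, Nat.card_eq_fintype_card, ← finrank_span_eq_card hindep, ← hspan]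

lemma exists_shortRootGrading (hshort : IsShortGrading 𝒢) (hH : H.toSubmodule ≤ 𝒢 0) :
    ∃ G : ShortRootGrading (rootSystem H),
      ∀ α i, (rootSystem H).root α ∈ weightSet H (𝒢 i) ↔ G.degree α = i := by
  obtain ⟨z, hz⟩ := exists_forall_mem_weightSet_apply_eq hH
  choose degree hdegree using fun α =>
    exists_mem_weightSet_of_mem_weightSet_top hH (root_mem_weightSet_top α)
  refine ⟨⟨Module.Dual.eval k H z, degree, fun α => hz _ _ (hdegree α), fun α => ?_⟩,
    fun α i => ⟨fun h => ?_, fun h => h ▸ hdegree α⟩⟩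
  · obtain ⟨x, hx, hx0, -⟩ := hdegree α
    obtain h | h | h := hshort.2 _ ((Submodule.ne_bot_iff _).2 ⟨x, hx, hx0⟩)
    all_goals simp [h]
  · exact Int.cast_injective ((hz _ _ (hdegree α)).symm.trans (hz _ _ h))

lemma weightSet_eq_image_root (hH : H.toSubmodule ≤ 𝒢 0) {i : ℤ} (hi : i ≠ 0) :
    weightSet H (𝒢 i) = (rootSystem H).root '' {α | (rootSystem H).root α ∈ weightSet H (𝒢 i)} := by
  ext χ
  refine ⟨fun hχ => ?_, ?_⟩
  · obtain ⟨α, rfl⟩ := exists_root_eq_of_mem_weightSet hχ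
      fun h => zero_notMem_weightSet hH hi (h ▸ hχ)
    exact ⟨α, hχ, rfl⟩
  · rintro ⟨α, hα, rfl⟩
    exact hα

lemma finrank_eq_ncard_weightSet_of_ne_zero (hH : H.toSubmodule ≤ 𝒢 0) {i : ℤ} (hi : i ≠ 0) :
    Module.finrank k (𝒢 i) = (weightSet H (𝒢 i)).ncard := by
  let V : LieSubmodule k H L :=
    { 𝒢 i with
      lie_mem := fun {y x} hx => by simpa using SetLike.GradedBracket.bracket_mem (hH y.2) hx }
  exact finrank_eq_ncard_weightSet V (zero_notMem_weightSet hH hi)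

end Weights

theorem mainTheorem6 {k L : Type*} [Field k] [IsAlgClosed k] [CharZero k]
    [LieRing L] [LieAlgebra k L] [FiniteDimensional k L] [LieAlgebra.IsSimple k L]
    (𝒢 : ℤ → Submodule k L) [GradedLieAlgebra 𝒢] (hshort : IsShortGrading 𝒢)
    (H : LieSubalgebra k L) [H.IsCartanSubalgebra] (hH : H.toSubmodule ≤ 𝒢 0)
    (b : (LieAlgebra.IsKilling.rootSystem H).Base)
    (hb : ∀ α ∈ b.support, ∃ n : ℕ,
      (LieAlgebra.IsKilling.rootSystem H).root α ∈ weightSet H (𝒢 (n : ℤ))) :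
    2 * (Module.finrank k (𝒢 1) : ℤ) - ((gradingEdges 𝒢 H b 1).ncard : ℤ) =
      (coxeterNumber b : ℤ) := by
  let P := LieAlgebra.IsKilling.rootSystem H
  obtain ⟨G, hG⟩ := exists_shortRootGrading hshort hH
  have hnonneg : ∀ i ∈ b.support, 0 ≤ G.degree i := fun i hi => by
    obtain ⟨n, hn⟩ := hb i hi
    exact (hG i n).1 hn ▸ n.cast_nonneg
  have hweights : weightSet H (𝒢 1) = P.root '' {j | G.degree j = 1} := by
    simpa only [hG] using weightSet_eq_image_root hH one_ne_zero
  have hsimple : simpleRootsZero 𝒢 H b = P.root '' {i | i ∈ b.support ∧ G.degree i = 0} := by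
    simp only [← hG]
    exact (Set.image_inter_preimage _ _ _).symm
  have hdim : Module.finrank k (𝒢 1) = Finset.card {j | G.degree j = 1} := by
    rw [finrank_eq_ncard_weightSet_of_ne_zero hH one_ne_zero, hweights,
      Set.ncard_image_of_injective _ P.root.injective, Set.ncard_eq_toFinset_card']
    simp
  have hedges : (gradingEdges 𝒢 H b 1).ncard =
      ∑ i ∈ b.support with G.degree i = 0, (G.upperEnds i).card := by
    rw [gradingEdges, hweights, hsimple, G.ncard_hasseEdges_degree_eq_one]
  obtain ⟨j, hj⟩ := Finset.card_pos.1 (hdim ▸ Submodule.one_le_finrank_iff.2 hshort.1)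
  have hj : G.degree j ≠ 0 := (Finset.mem_filter.1 hj).2 ▸ one_ne_zero
  have := ShortRootGrading.sum_card_upperEnds_add_coxeterNumber hnonneg hj
  omega
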